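/- A $k\times k$ complex matrix $B$ dilates to a square complex matrix $M$ if $M$ is unitarily similar to a block matrix $\begin{bmatrix} B & * \\ * & *\end{bmatrix}$; the zero-dilation index $d(M)$ is the largest integer $k$ for which the $k\times k$ zero matrix dilates to $M$. For $A\in M_n(\mathbb C)$ and $m\ge 2$, let $\mathcal K_m(A)$ be the $mn\times mn$ block upper triangular matrix with $m\times m$ blocks of size $n\times n$, whose $(i,j)$ block is $A^{j-i}$ if $i<j$ and $0$ if $i\ge j$. Let $m,n\in\mathbb N$ with $m\ge 3$ and let $A\in M_n(\mathbb C)$ be nonsingular and normal. Let $\lambda_1,\dots,\lambda_n$ be the eigenvalues of $A$, counted with multiplicity. For each $i\in\{1,\dots,n\}$, let $k_i$ be the largest element of $\{1,\dots,m-2\}$ for which $$\cos\left(\frac{k_i\pi}{m-1}\right)<|\lambda_i|\le\cos\left(\frac{(k_i-1)\pi}{m-1}\right);$$ if no such element exists, let $k_i:=1$. Then $$d(\mathcal K_m(A))=k_1+\cdots+k_n.$$ -/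

import Mathlib

open scoped Matrix

namespace BlockKMS

/-- The `k × k` matrix `B` dilates to the square matrix `A` (indexed by a finite type `ι`): `A` is
unitarily similar to a block matrix with upper left block `B`. The equivalence `e` only fixes an
ordering of the index set of `A`. -/
def Dilates {ι : Type*} [Fintype ι] [DecidableEq ι] {k : ℕ}
    (B : Matrix (Fin k) (Fin k) ℂ) (A : Matrix ι ι ℂ) : Prop :=
  ∃ (l : ℕ) (e : ι ≃ Fin k ⊕ Fin l), ∃ U ∈ Matrix.unitaryGroup ι ℂ,
    ∃ (X : Matrix (Fin k) (Fin l) ℂ) (Y : Matrix (Fin l) (Fin k) ℂ) (Z : Matrix (Fin l) (Fin l) ℂ),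
      Matrix.reindex e e (Uᴴ * A * U) = Matrix.fromBlocks B X Y Z

/-- The zero-dilation index of `A`: the largest `k` such that the `k × k` zero matrix dilates to
`A`. -/
noncomputable def zeroDilationIndex {ι : Type*} [Fintype ι] [DecidableEq ι]
    (A : Matrix ι ι ℂ) : ℕ :=
  sSup {k : ℕ | Dilates (0 : Matrix (Fin k) (Fin k) ℂ) A}

/-- The supremum defining the zero-dilation index is attained, hence a genuine maximum. -/
theorem isGreatest_zeroDilationIndex {ι : Type*} [Fintype ι] [DecidableEq ι]
    (A : Matrix ι ι ℂ) :
    IsGreatest {k : ℕ | Dilates (0 : Matrix (Fin k) (Fin k) ℂ) A} (zeroDilationIndex A) := by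
  have hb : BddAbove {k : ℕ | Dilates (0 : Matrix (Fin k) (Fin k) ℂ) A} := by
    refine ⟨Fintype.card ι, ?_⟩
    rintro k ⟨l, e, -⟩
    have h := Fintype.card_congr e
    simp only [Fintype.card_sum, Fintype.card_fin] at h
    omega
  have hne : {k : ℕ | Dilates (0 : Matrix (Fin k) (Fin k) ℂ) A}.Nonempty := by
    refine ⟨0, Fintype.card ι, (Fintype.equivFin ι).trans (Equiv.emptySum (Fin 0) _).symm, 1,
      one_mem _, 0, 0, Matrix.toBlocks₂₂ (Matrix.reindex
        ((Fintype.equivFin ι).trans (Equiv.emptySum (Fin 0) _).symm)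
        ((Fintype.equivFin ι).trans (Equiv.emptySum (Fin 0) _).symm)
        ((1 : Matrix ι ι ℂ)ᴴ * A * 1)), ?_⟩
    ext i j
    rcases i with i | i
    · exact i.elim0
    · rcases j with j | j
      · exact j.elim0
      · rfl
  exact ⟨Nat.sSup_mem hne hb, fun k hk => le_csSup hb hk⟩

/-- The `mn × mn` block upper triangular KMS matrix of `A`: an `m × m` array of `n × n` blocks whose
`(i, j)` block is `A ^ (j - i)` if `i < j`, and `0` otherwise. -/
def kms (m : ℕ) {n : ℕ} (A : Matrix (Fin n) (Fin n) ℂ) :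
    Matrix (Fin m × Fin n) (Fin m × Fin n) ℂ :=
  Matrix.of fun p q =>
    if p.1 < q.1 then (A ^ ((q.1 : ℕ) - (p.1 : ℕ))) p.2 q.2 else 0

open Classical in
/-- The indices `k ∈ {1, …, m - 2}` with `cos (kπ/(m-1)) < r ≤ cos ((k-1)π/(m-1))`. -/
noncomputable def cosIndices (m : ℕ) (r : ℝ) : Finset ℕ :=
  (Finset.Icc 1 (m - 2)).filter fun k =>
    Real.cos ((k : ℝ) * Real.pi / ((m : ℝ) - 1)) < r ∧
      r ≤ Real.cos (((k : ℝ) - 1) * Real.pi / ((m : ℝ) - 1))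

open Classical in
/-- The largest element of `cosIndices m r`, or `1` if there is none. -/
noncomputable def cosIndex (m : ℕ) (r : ℝ) : ℕ :=
  if h : (cosIndices m r).Nonempty then (cosIndices m r).max' h else 1

end BlockKMS

/-! The zero matrix of size `k` dilates to `M` exactly when the form `y* M x` vanishes on a
`k`-dimensional subspace. Such a subspace meets trivially any subspace on which `Re x* M x < 0`, so
an isotropic and a negative subspace of complementary dimensions determine the index
(`zeroDilationIndex_eq`). Both notions survive congruence `P* M P` and add over diagonal blocks. No
norms need preserving, so `P` may be any invertible matrix.

Diagonalising `A` splits `kms m A` into scalar blocks with parameters `μ a`; phases are removed by a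
diagonal congruence, leaving `r = |μ a| > 0`. With `S` the shift, congruence by `1 - rS` turns the
block into `r(S - r S*S)`. Two leading coordinates then split off, giving one isotropic and one
negative dimension each and leaving `S - r` in size `p = m - 2`.

The Hermitian part of `S - r` has eigenvalues `cos θ - r`, `θ = lπ/(p+1)`, `1 ≤ l ≤ p`. If `j` of
them are nonnegative, the others span a negative subspace of dimension `p - j`, and each nonnegative
one gives a solution of `Mv = μ M* v` with `μ ≤ -1`; these span an isotropic subspace of dimension
`j`. The bracketing of `r` by cosines says that the index is `j + 1`. -/

namespace BlockKMS

open Module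

/-! ### Isotropic and negative subspaces under congruence and scaling -/

section Subspaces

variable {ι : Type*} [Fintype ι]

/-- The sesquilinear form of `M` vanishes identically on some `k`-dimensional subspace. -/
def HasIsotropicSubspace (M : Matrix ι ι ℂ) (k : ℕ) : Prop :=
  ∃ W : Submodule ℂ (ι → ℂ), finrank ℂ W = k ∧ ∀ x ∈ W, ∀ y ∈ W, star y ⬝ᵥ M *ᵥ x = 0

/-- The real part of the quadratic form of `M` is negative definite on some `k`-dimensional
subspace. -/
def HasNegativeSubspace (M : Matrix ι ι ℂ) (k : ℕ) : Prop :=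
  ∃ W : Submodule ℂ (ι → ℂ), finrank ℂ W = k ∧ ∀ x ∈ W, x ≠ 0 → (star x ⬝ᵥ M *ᵥ x).re < 0

theorem HasIsotropicSubspace.of_linearIndependent {M : Matrix ι ι ℂ} {κ : Type*} [Fintype κ]
    {v : κ → ι → ℂ} (hv : LinearIndependent ℂ v) (h : ∀ a b, star (v b) ⬝ᵥ M *ᵥ v a = 0) :
    HasIsotropicSubspace M (Fintype.card κ) := by
  refine ⟨Submodule.span ℂ (Set.range v), finrank_span_eq_card hv, fun x hx y hy => ?_⟩
  induction hx using Submodule.span_induction with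
  | mem x hx =>
    obtain ⟨a, rfl⟩ := hx
    induction hy using Submodule.span_induction with
    | mem y hy => obtain ⟨b, rfl⟩ := hy; exact h a b
    | zero => simp
    | add y z _ _ hy hz => rw [star_add, add_dotProduct, hy, hz, add_zero]
    | smul c y _ hy => rw [star_smul, smul_dotProduct, hy, smul_zero]
  | zero => simp
  | add x z _ _ hx hz => rw [Matrix.mulVec_add, dotProduct_add, hx, hz, add_zero]
  | smul c x _ hx => rw [Matrix.mulVec_smul, dotProduct_smul, hx, smul_zero]

/-- On a common nonzero vector the form would be both zero and of negative real part. -/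
theorem HasIsotropicSubspace.add_le {M : Matrix ι ι ℂ} {k l : ℕ} (hk : HasIsotropicSubspace M k)
    (hl : HasNegativeSubspace M l) : k + l ≤ Fintype.card ι := by
  obtain ⟨V, rfl, hV⟩ := hk
  obtain ⟨W, rfl, hW⟩ := hl
  have hd : Disjoint V W := by
    rw [Submodule.disjoint_def]
    intro x hxV hxW
    by_contra hx
    have := hW x hxW hx
    rw [hV x hxV x hxV] at this
    simp at this
  simpa using Submodule.finrank_add_finrank_le_of_disjoint hd

theorem dotProduct_conjTranspose_mul_mul (P M : Matrix ι ι ℂ) (x y : ι → ℂ) :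
    star y ⬝ᵥ (Pᴴ * M * P) *ᵥ x = star (P *ᵥ y) ⬝ᵥ M *ᵥ (P *ᵥ x) := by
  rw [Matrix.star_mulVec, ← Matrix.dotProduct_mulVec, Matrix.mulVec_mulVec, Matrix.mulVec_mulVec,
    mul_assoc]

theorem finrank_map_mulVecLin [DecidableEq ι] {P : Matrix ι ι ℂ} (hP : IsUnit P) (W : Submodule ℂ (ι → ℂ)) :
    finrank ℂ (W.map P.mulVecLin) = finrank ℂ W :=
  (Submodule.equivMapOfInjective P.mulVecLin (Matrix.mulVec_injective_iff_isUnit.2 hP)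
    W).finrank_eq.symm

theorem HasIsotropicSubspace.of_congr [DecidableEq ι] {P M : Matrix ι ι ℂ} (hP : IsUnit P) {k : ℕ}
    (h : HasIsotropicSubspace (Pᴴ * M * P) k) : HasIsotropicSubspace M k := by
  obtain ⟨W, rfl, hW⟩ := h
  refine ⟨W.map P.mulVecLin, finrank_map_mulVecLin hP W, ?_⟩
  rintro _ ⟨x, hx, rfl⟩ _ ⟨y, hy, rfl⟩
  have := hW x hx y hy
  rwa [dotProduct_conjTranspose_mul_mul] at this

theorem HasNegativeSubspace.of_congr [DecidableEq ι] {P M : Matrix ι ι ℂ} (hP : IsUnit P) {k : ℕ}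
    (h : HasNegativeSubspace (Pᴴ * M * P) k) : HasNegativeSubspace M k := by
  obtain ⟨W, rfl, hW⟩ := h
  refine ⟨W.map P.mulVecLin, finrank_map_mulVecLin hP W, ?_⟩
  rintro _ ⟨x, hx, rfl⟩ hne
  have := hW x hx (by rintro rfl; simp at hne)
  rwa [dotProduct_conjTranspose_mul_mul] at this

theorem HasIsotropicSubspace.real_smul {M : Matrix ι ι ℂ} {k : ℕ} (h : HasIsotropicSubspace M k)
    (r : ℝ) : HasIsotropicSubspace (r • M) k := by
  obtain ⟨W, rfl, hW⟩ := h
  refine ⟨W, rfl, fun x hx y hy => ?_⟩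
  rw [Matrix.smul_mulVec, dotProduct_smul, hW x hx y hy, smul_zero]

theorem HasNegativeSubspace.real_smul {M : Matrix ι ι ℂ} {k : ℕ} (h : HasNegativeSubspace M k)
    {r : ℝ} (hr : 0 < r) : HasNegativeSubspace (r • M) k := by
  obtain ⟨W, rfl, hW⟩ := h
  refine ⟨W, rfl, fun x hx hne => ?_⟩
  rw [Matrix.smul_mulVec, dotProduct_smul, Complex.smul_re, smul_eq_mul]
  exact mul_neg_of_pos_of_neg hr (hW x hx hne)

end Subspaces

/-! ### Direct sums over diagonal blocks -/

section BlockDiagonal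

variable {ι κ : Type*} [Fintype ι] [Fintype κ]

/-- The vectors whose slice at every `a` lies in `W a`. -/
def sliceSubmodule (W : κ → Submodule ℂ (ι → ℂ)) : Submodule ℂ (ι × κ → ℂ) where
  carrier := {x | ∀ a, (fun i => x (i, a)) ∈ W a}
  add_mem' hx hy a := (W a).add_mem (hx a) (hy a)
  zero_mem' a := (W a).zero_mem
  smul_mem' c _ hx a := (W a).smul_mem c (hx a)

theorem finrank_sliceSubmodule (W : κ → Submodule ℂ (ι → ℂ)) :
    finrank ℂ (sliceSubmodule W) = ∑ a, finrank ℂ (W a) := by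
  rw [← Module.finrank_pi_fintype ℂ]
  refine LinearEquiv.finrank_eq (R := ℂ) (M := sliceSubmodule W) (N := ∀ a, W a)
    { toFun := fun x a => ⟨fun i => x.1 (i, a), x.2 a⟩
      invFun := fun w => ⟨fun p => (w p.2).1 p.1, fun a => (w a).2⟩
      map_add' := fun x y => rfl
      map_smul' := fun c x => rfl
      left_inv := fun x => rfl
      right_inv := fun w => rfl }

variable [DecidableEq κ]

theorem dotProduct_blockDiagonal_mulVec (M : κ → Matrix ι ι ℂ) (x y : ι × κ → ℂ) :
    star y ⬝ᵥ Matrix.blockDiagonal M *ᵥ x =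
      ∑ a, star (fun i => y (i, a)) ⬝ᵥ M a *ᵥ (fun i => x (i, a)) := by
  simp only [dotProduct, Matrix.mulVec, Fintype.sum_prod_type, Matrix.blockDiagonal_apply,
    Pi.star_apply]
  rw [Finset.sum_comm]
  simp

theorem HasIsotropicSubspace.blockDiagonal {M : κ → Matrix ι ι ℂ} {k : κ → ℕ}
    (h : ∀ a, HasIsotropicSubspace (M a) (k a)) :
    HasIsotropicSubspace (Matrix.blockDiagonal M) (∑ a, k a) := by
  choose W hk hW using h
  refine ⟨sliceSubmodule W, by simp [finrank_sliceSubmodule, hk], fun x hx y hy => ?_⟩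
  rw [dotProduct_blockDiagonal_mulVec]
  exact Finset.sum_eq_zero fun a _ => hW a _ (hx a) _ (hy a)

theorem HasNegativeSubspace.blockDiagonal {M : κ → Matrix ι ι ℂ} {k : κ → ℕ}
    (h : ∀ a, HasNegativeSubspace (M a) (k a)) :
    HasNegativeSubspace (Matrix.blockDiagonal M) (∑ a, k a) := by
  choose W hk hW using h
  refine ⟨sliceSubmodule W, by simp [finrank_sliceSubmodule, hk], fun x hx hne => ?_⟩
  rw [dotProduct_blockDiagonal_mulVec, Complex.re_sum]
  obtain ⟨⟨i, a⟩, hia⟩ := Function.ne_iff.1 hne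
  refine Finset.sum_neg' (fun b _ => ?_) ⟨a, Finset.mem_univ a, hW a _ (hx a) fun h =>
    hia (congrFun h i)⟩
  by_cases hb : (fun i => x (i, b)) = 0
  · simp [hb]
  · exact (hW b _ (hx b) hb).le

end BlockDiagonal

/-! ### Zero dilations as isotropic subspaces -/

section Dilation

variable {ι : Type*} [Fintype ι]

theorem conjTranspose_mul_mul_apply (U M : Matrix ι ι ℂ) (a b : ι) :
    (Uᴴ * M * U) b a = star (U.col b) ⬝ᵥ M *ᵥ U.col a := by
  rw [mul_assoc, Matrix.mul_apply]
  rfl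

variable [DecidableEq ι]

theorem Dilates.hasIsotropicSubspace {M : Matrix ι ι ℂ} {k : ℕ}
    (h : Dilates (0 : Matrix (Fin k) (Fin k) ℂ) M) : HasIsotropicSubspace M k := by
  obtain ⟨l, e, U, hU, X, Y, Z, h⟩ := h
  have hli : LinearIndependent ℂ U.col := Matrix.linearIndependent_cols_of_isUnit
    (Unitary.toUnits ⟨U, hU⟩).isUnit
  have := HasIsotropicSubspace.of_linearIndependent (M := M)
    (hli.comp (fun a : Fin k => e.symm (Sum.inl a)) (by intro a b; simp)) fun a b => by
      have := congrFun (congrFun h (Sum.inl b)) (Sum.inl a)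
      simpa [conjTranspose_mul_mul_apply] using this
  simpa using this

theorem OrthonormalBasis.of_mem_unitaryGroup (b : OrthonormalBasis ι ℂ (EuclideanSpace ℂ ι)) :
    (Matrix.of fun i j => b j i) ∈ Matrix.unitaryGroup ι ℂ := by
  rw [Matrix.mem_unitaryGroup_iff']
  ext i j
  have := orthonormal_iff_ite.1 b.orthonormal i j
  rw [EuclideanSpace.inner_eq_star_dotProduct] at this
  simp only [Matrix.mul_apply, Matrix.one_apply, ← this, dotProduct]
  exact Finset.sum_congr rfl fun _ _ => mul_comm _ _

/-- An orthonormal basis of the isotropic subspace, extended to the whole space, supplies the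
columns of the unitary. -/
theorem HasIsotropicSubspace.dilates {M : Matrix ι ι ℂ} {k : ℕ}
    (h : HasIsotropicSubspace M k) : Dilates (0 : Matrix (Fin k) (Fin k) ℂ) M := by
  obtain ⟨W, hk, hW⟩ := h
  have hle : k ≤ Fintype.card ι := by
    simpa [hk] using Submodule.finrank_le W
  obtain ⟨l, hl⟩ := Nat.exists_eq_add_of_le hle
  let e : ι ≃ Fin k ⊕ Fin l := Fintype.equivOfCardEq (by simpa using hl)
  let W' : Submodule ℂ (EuclideanSpace ℂ ι) := W.comap (WithLp.linearEquiv 2 ℂ (ι → ℂ)).toLinearMap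
  have hW' : finrank ℂ W' = k := by
    rw [← hk]
    exact ((WithLp.linearEquiv 2 ℂ (ι → ℂ)).submoduleMap W').finrank_eq.trans (by
      rw [Submodule.map_comap_eq_of_surjective (LinearEquiv.surjective _)])
  let w : OrthonormalBasis (Fin k) ℂ W' := (stdOrthonormalBasis ℂ W').reindex (finCongr hW')
  let v : Fin k ⊕ Fin l → EuclideanSpace ℂ ι := Sum.elim (fun a => (w a : EuclideanSpace ℂ ι)) 0
  have hv : Orthonormal ℂ ((Set.range Sum.inl).domRestrict v) := by
    have hw : Orthonormal ℂ fun a => (w a : EuclideanSpace ℂ ι) :=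
      w.orthonormal.comp_linearIsometry W'.subtypeₗᵢ
    rw [orthonormal_iff_ite] at hw ⊢
    rintro ⟨_, a, rfl⟩ ⟨_, b, rfl⟩
    simpa [v, Subtype.ext_iff] using hw a b
  obtain ⟨b, hb⟩ := hv.exists_orthonormalBasis_extension_of_card_eq (by simpa using hl)
  set U : Matrix ι ι ℂ := Matrix.of fun i j => b.reindex e.symm j i with hU
  have key : ∀ a, U.col (e.symm (Sum.inl a)) ∈ W := by
    intro a
    have hba : b (Sum.inl a) = (w a : EuclideanSpace ℂ ι) := hb _ ⟨a, rfl⟩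
    have h2 : U.col (e.symm (Sum.inl a)) =
        WithLp.linearEquiv 2 ℂ (ι → ℂ) (w a : EuclideanSpace ℂ ι) := by
      ext i
      simp [hU, Matrix.col, ← hba]
    rw [h2]
    exact (w a).2
  refine ⟨l, e, U, OrthonormalBasis.of_mem_unitaryGroup (b.reindex e.symm),
    (Matrix.reindex e e (Uᴴ * M * U)).toBlocks₁₂, (Matrix.reindex e e (Uᴴ * M * U)).toBlocks₂₁,
    (Matrix.reindex e e (Uᴴ * M * U)).toBlocks₂₂, ?_⟩
  rw [show (0 : Matrix (Fin k) (Fin k) ℂ) = (Matrix.reindex e e (Uᴴ * M * U)).toBlocks₁₁ from ?_,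
    Matrix.fromBlocks_toBlocks]
  ext i j
  refine Eq.symm ((conjTranspose_mul_mul_apply U M _ _).trans ?_)
  exact hW _ (key j) _ (key i)

theorem zeroDilationIndex_eq {M : Matrix ι ι ℂ} {k l : ℕ} (hk : HasIsotropicSubspace M k)
    (hl : HasNegativeSubspace M l) (hkl : Fintype.card ι ≤ k + l) : zeroDilationIndex M = k := by
  have h := isGreatest_zeroDilationIndex M
  refine le_antisymm ?_ (h.2 hk.dilates)
  have := (Dilates.hasIsotropicSubspace h.1).add_le hl
  omega

end Dilation

/-! ### Unitary diagonalisation of normal matrices -/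

section Spectral

variable {n : ℕ}

/-- Normality makes the Hermitian matrices `A + A*` and `i(A - A*)` commute, so they have a common
orthonormal eigenbasis, and `A` is a linear combination of them. -/
theorem exists_orthonormalBasis_eigenvectors (A : Matrix (Fin n) (Fin n) ℂ) (hA : IsStarNormal A) :
    ∃ (b : OrthonormalBasis (Fin n) ℂ (EuclideanSpace ℂ (Fin n))) (μ : Fin n → ℂ),
      ∀ a, A.toEuclideanLin (b a) = μ a • b a := by
  classical
  have hc : A * Aᴴ = Aᴴ * A := hA.star_comm_self.eq.symm
  set R : Matrix (Fin n) (Fin n) ℂ := A + Aᴴ with hR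
  set J : Matrix (Fin n) (Fin n) ℂ := Complex.I • (A - Aᴴ) with hJ
  have hRs : R.toEuclideanLin.IsSymmetric := by
    rw [Matrix.isSymmetric_toEuclideanLin_iff]
    simp [Matrix.IsHermitian, hR, add_comm]
  have hJs : J.toEuclideanLin.IsSymmetric := by
    rw [Matrix.isSymmetric_toEuclideanLin_iff]
    simp [Matrix.IsHermitian, hJ, ← smul_neg]
  have hRJ : Commute R.toEuclideanLin J.toEuclideanLin := by
    have : R * J = J * R := by
      simp only [hR, hJ, Matrix.mul_smul, Matrix.smul_mul]
      congr 1
      rw [add_mul, mul_sub, mul_sub, sub_mul, mul_add, mul_add, hc]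
      abel
    have h2 := congrArg Matrix.toEuclideanLin this
    rw [Commute, SemiconjBy]
    ext x : 1
    have h3 := congrArg (fun f => f x) h2
    simpa [Matrix.toLpLin_apply, Matrix.mulVec_mulVec] using h3
  have hint := DirectSum.isInternal_ne_bot_iff.mpr
    (LinearMap.IsSymmetric.directSum_isInternal_of_commute hRs hJs hRJ)
  have hort := (LinearMap.IsSymmetric.orthogonalFamily_eigenspace_inf_eigenspace hRs hJs)
  have := hort.independent
  let := this.fintypeNeBotOfFiniteDimensional
  have hfin : finrank ℂ (EuclideanSpace ℂ (Fin n)) = n := by simp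
  refine ⟨hint.subordinateOrthonormalBasis hfin (hort.comp Subtype.val_injective), fun a =>
    (1 / 2 : ℂ) * ((hint.subordinateOrthonormalBasisIndex hfin a
      (hort.comp Subtype.val_injective)).1.2 - Complex.I *
      (hint.subordinateOrthonormalBasisIndex hfin a (hort.comp Subtype.val_injective)).1.1),
    fun a => ?_⟩
  have h := hint.subordinateOrthonormalBasis_subordinate hfin a (hort.comp Subtype.val_injective)
  rw [Submodule.mem_inf, Module.End.mem_eigenspace_iff, Module.End.mem_eigenspace_iff] at h
  have hAe : A = (1 / 2 : ℂ) • (R - Complex.I • J) := by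
    rw [hR, hJ, smul_smul, Complex.I_mul_I]
    ext i j
    simp
    ring
  conv_lhs => rw [hAe]
  rw [map_smul, map_sub, map_smul, LinearMap.smul_apply, LinearMap.sub_apply, LinearMap.smul_apply,
    h.1, h.2, smul_smul, ← sub_smul, smul_smul]

theorem exists_unitary_mul_eq_mul_diagonal (A : Matrix (Fin n) (Fin n) ℂ) (hA : IsStarNormal A) :
    ∃ U ∈ Matrix.unitaryGroup (Fin n) ℂ, ∃ μ : Fin n → ℂ, A * U = U * Matrix.diagonal μ := by
  obtain ⟨b, μ, h⟩ := exists_orthonormalBasis_eigenvectors A hA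
  refine ⟨_, OrthonormalBasis.of_mem_unitaryGroup b, μ, ?_⟩
  ext i a
  have := congrArg (fun x : EuclideanSpace ℂ (Fin n) => x i) (h a)
  simpa [Matrix.toLpLin_apply, Matrix.mulVec, dotProduct, Matrix.mul_apply,
    Matrix.diagonal_apply, mul_comm] using this

theorem map_eq_map_of_mul_eq_mul_diagonal {A U : Matrix (Fin n) (Fin n) ℂ} {μ lam : Fin n → ℂ}
    (hU : U ∈ Matrix.unitaryGroup (Fin n) ℂ) (h : A * U = U * Matrix.diagonal μ)
    (hlam : A.charpoly.roots = Finset.univ.val.map lam) :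
    Finset.univ.val.map μ = Finset.univ.val.map lam := by
  have hA : A = U * Matrix.diagonal μ * star U := by
    rw [← h, mul_assoc, (Matrix.mem_unitaryGroup_iff.1 hU), mul_one]
  rw [← hlam, hA, mul_assoc, Matrix.charpoly_mul_comm, mul_assoc,
    (Matrix.mem_unitaryGroup_iff'.1 hU), mul_one, Matrix.charpoly_diagonal,
    Polynomial.roots_prod _ _ (Finset.prod_ne_zero_iff.2 fun i _ => Polynomial.X_sub_C_ne_zero _)]
  simp

end Spectral

/-! ### Congruences down to the shift form -/

/-- The `m × m` matrix with entries `z ^ (j - i)` strictly above the diagonal, `0` elsewhere. -/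
def scalarKMS (m : ℕ) (z : ℂ) : Matrix (Fin m) (Fin m) ℂ :=
  Matrix.of fun i j => if i < j then z ^ ((j : ℕ) - (i : ℕ)) else 0

open scoped Kronecker in
-- Conjugation by `1 ⊗ U` works because the same `U` diagonalises every power of `A`.
theorem exists_congr_kms (m : ℕ) {n : ℕ} {A U : Matrix (Fin n) (Fin n) ℂ} {μ : Fin n → ℂ}
    (hU : U ∈ Matrix.unitaryGroup (Fin n) ℂ) (h : A * U = U * Matrix.diagonal μ) :
    ∃ P, IsUnit P ∧ Pᴴ * kms m A * P = Matrix.blockDiagonal fun a => scalarKMS m (μ a) := by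
  have hP : ((1 : Matrix (Fin m) (Fin m) ℂ) ⊗ₖ U) ∈ Matrix.unitaryGroup (Fin m × Fin n) ℂ :=
    Matrix.kronecker_mem_unitary (one_mem _) hU
  refine ⟨(1 : Matrix (Fin m) (Fin m) ℂ) ⊗ₖ U, (Unitary.toUnits ⟨_, hP⟩).isUnit, ?_⟩
  have key : kms m A * ((1 : Matrix (Fin m) (Fin m) ℂ) ⊗ₖ U) =
      ((1 : Matrix (Fin m) (Fin m) ℂ) ⊗ₖ U) * Matrix.blockDiagonal fun a => scalarKMS m (μ a) := by
    have hpow : ∀ d : ℕ, A ^ d * U = U * Matrix.diagonal (μ ^ d) := by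
      intro d
      rw [← Matrix.diagonal_pow]
      exact ((show SemiconjBy U (Matrix.diagonal μ) A from h.symm).pow_right d).symm
    ext ⟨i, a⟩ ⟨j, b⟩
    have := congrFun (congrFun (hpow ((j : ℕ) - i)) a) b
    simp only [Matrix.mul_apply, Matrix.diagonal_apply] at this
    simp only [Matrix.mul_apply, Fintype.sum_prod_type, kms, scalarKMS, Matrix.of_apply,
      Matrix.kroneckerMap_apply, Matrix.blockDiagonal_apply, Matrix.one_apply]
    rw [Finset.sum_eq_single j (by intro k _ hk; simp [hk]) (by simp),
      Finset.sum_eq_single i (by intro k _ hk; simp [hk.symm]) (by simp)]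
    by_cases hij : i < j
    · simpa [hij] using this
    · simp [hij]
  rw [mul_assoc, key, ← mul_assoc, ← Matrix.star_eq_conjTranspose,
    Matrix.mem_unitaryGroup_iff'.1 hP, one_mul]

theorem exists_congr_scalarKMS_norm (m : ℕ) {z : ℂ} (hz : z ≠ 0) :
    ∃ P, IsUnit P ∧ Pᴴ * scalarKMS m z * P = scalarKMS m (‖z‖ : ℝ) := by
  have hz' : (‖z‖ : ℂ) ≠ 0 := by simpa using hz
  have hu : star ((‖z‖ : ℂ) / z) * ((‖z‖ : ℂ) / z) = 1 := by
    rw [Complex.star_def, ← Complex.normSq_eq_conj_mul_self, Complex.normSq_eq_norm_sq]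
    simp [hz]
  -- The ratio `‖z‖ / z` has modulus one, so in entry `(i, j)` the phases collapse to the power `j -
  -- i`, turning `z` into `‖z‖`.
  refine ⟨Matrix.diagonal fun i : Fin m => ((‖z‖ : ℂ) / z) ^ (i : ℕ), ?_, ?_⟩
  · rw [Matrix.isUnit_iff_isUnit_det, Matrix.det_diagonal, isUnit_iff_ne_zero,
      Finset.prod_ne_zero_iff]
    exact fun i _ => pow_ne_zero _ (div_ne_zero hz' hz)
  · ext i j
    rw [Matrix.diagonal_conjTranspose, Matrix.mul_diagonal, Matrix.diagonal_mul]
    simp only [scalarKMS, Matrix.of_apply, Pi.star_apply]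
    split_ifs with hij
    · obtain ⟨d, hd⟩ := Nat.exists_eq_add_of_le (Fin.lt_def.1 hij).le
      rw [hd, Nat.add_sub_cancel_left, pow_add, star_pow]
      calc _ = (star ((‖z‖ : ℂ) / z) * ((‖z‖ : ℂ) / z)) ^ (i : ℕ) * (z * ((‖z‖ : ℂ) / z)) ^ d := by
            rw [mul_pow, mul_pow]; ring
        _ = _ := by rw [hu, one_pow, one_mul, mul_div_cancel₀ _ hz]
    · simp

/-- The nilpotent upper shift. -/
def shift (m : ℕ) : Matrix (Fin m) (Fin m) ℂ :=
  Matrix.of fun i j => if (i : ℕ) + 1 = j then 1 else 0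

theorem shift_mulVec_apply {m : ℕ} (x : Fin m → ℂ) (i : Fin m) :
    (shift m *ᵥ x) i = if h : (i : ℕ) + 1 < m then x ⟨i + 1, h⟩ else 0 := by
  simp only [Matrix.mulVec, dotProduct, shift, Matrix.of_apply, ite_mul, one_mul, zero_mul]
  split_ifs with h
  · rw [Finset.sum_eq_single ⟨i + 1, h⟩]
    · simp
    · intro j _ hj
      rw [if_neg]
      exact fun h => hj (Fin.ext h.symm)
    · simp
  · refine Finset.sum_eq_zero fun j _ => if_neg ?_
    have := j.2
    omega

theorem isUnit_of_upperTriangular {m : ℕ} {M : Matrix (Fin m) (Fin m) ℂ}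
    (h : ∀ i j, j < i → M i j = 0) (hd : ∀ i, M i i ≠ 0) : IsUnit M := by
  rw [Matrix.isUnit_iff_isUnit_det, Matrix.det_of_isUpperTriangular fun i j hij => h i j hij,
    isUnit_iff_ne_zero, Finset.prod_ne_zero_iff]
  exact fun i _ => hd i

theorem scalarKMS_eq (m : ℕ) (r : ℝ) :
    scalarKMS m r = r • shift m + r • (scalarKMS m r * shift m) := by
  ext i j
  simp only [Matrix.add_apply, Matrix.smul_apply, Matrix.mul_apply, scalarKMS, shift,
    Matrix.of_apply, mul_ite, mul_one, mul_zero]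
  obtain ⟨j, hj⟩ := j
  cases j with
  | zero => simp [Fin.lt_def]
  | succ j =>
    rw [Finset.sum_eq_single ⟨j, by omega⟩ (by
      intro k _ hk
      rw [if_neg]
      exact fun h => hk (Fin.ext (by simpa using h))) (by simp)]
    simp only [Fin.lt_def, if_true]
    rcases lt_trichotomy (i : ℕ) j with h | h | h
    · rw [if_pos (by omega), if_neg (by omega), if_pos h, Nat.succ_sub h.le, pow_succ]
      simp [mul_comm]
    · simp [h]
    · rw [if_neg (by omega), if_neg (by omega), if_neg (by omega)]
      simp

/-- The geometric recursion `K = rS + rKS` gives `K(1 - rS) = rS`; multiplying on the left by `(1 -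
rS)*` finishes. -/
theorem exists_congr_scalarKMS (m : ℕ) (r : ℝ) :
    ∃ P, IsUnit P ∧
      Pᴴ * scalarKMS m r * P = r • (shift m - r • ((shift m)ᴴ * shift m)) := by
  refine ⟨1 - r • shift m, isUnit_of_upperTriangular (fun i j hij => ?_) fun i => ?_, ?_⟩
  · rw [Fin.lt_def] at hij
    have hne : i ≠ j := fun h => hij.ne' (congrArg Fin.val h)
    simp [shift, Matrix.one_apply_ne hne, show ¬ ((i : ℕ) + 1 = j) by omega]
  · simp [shift]
  · have h : scalarKMS m r * (1 - r • shift m) = r • shift m := by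
      rw [mul_sub, mul_one, Matrix.mul_smul, sub_eq_iff_eq_add]
      exact scalarKMS_eq m r
    rw [mul_assoc, h, Matrix.conjTranspose_sub, Matrix.conjTranspose_one,
      Matrix.conjTranspose_smul, star_trivial, sub_mul, one_mul, Matrix.smul_mul, Matrix.mul_smul,
      smul_sub]

/-! ### Splitting off two leading coordinates -/

theorem dotProduct_shiftForm (n : ℕ) (r : ℝ) (x y : Fin (n + 1) → ℂ) :
    star y ⬝ᵥ (shift (n + 1) - r • ((shift (n + 1))ᴴ * shift (n + 1))) *ᵥ x =
      ∑ i : Fin n, (star (y i.castSucc) * x i.succ - r * (star (y i.succ) * x i.succ)) := by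
  have hc : ∀ (x : Fin (n + 1) → ℂ) (i : Fin n), (shift (n + 1) *ᵥ x) i.castSucc = x i.succ := by
    intro x i
    rw [shift_mulVec_apply, dif_pos (by simp)]
    rfl
  have hl : ∀ x : Fin (n + 1) → ℂ, (shift (n + 1) *ᵥ x) (Fin.last n) = 0 := by
    intro x
    rw [shift_mulVec_apply, dif_neg (by simp)]
  rw [Matrix.sub_mulVec, dotProduct_sub, Matrix.smul_mulVec, dotProduct_smul,
    ← Matrix.mulVec_mulVec, Matrix.dotProduct_mulVec _ (shift (n + 1))ᴴ, ← Matrix.star_mulVec]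
  simp only [dotProduct, Fin.sum_univ_castSucc, hc, hl, Pi.star_apply, star_zero, mul_zero,
    add_zero, Finset.sum_sub_distrib, Finset.smul_sum, Complex.real_smul]

/-- The diagonal of `S*S` vanishes only in the first place, so past the first two coordinates the
form is that of `S - r`. The first one enters only through `star t * w`. -/
theorem dotProduct_shiftForm_cons (q : ℕ) (r : ℝ) (s w t z : ℂ) (x y : Fin (q + 1) → ℂ) :
    star (Fin.cons t (Fin.cons z y : Fin (q + 2) → ℂ) : Fin (q + 3) → ℂ) ⬝ᵥ
      (shift (q + 3) - r • ((shift (q + 3))ᴴ * shift (q + 3))) *ᵥ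
        (Fin.cons s (Fin.cons w x : Fin (q + 2) → ℂ) : Fin (q + 3) → ℂ) =
      star t * w - r * (star z * w) + star z * x 0 +
        star y ⬝ᵥ (shift (q + 1) - r • (1 : Matrix _ _ ℂ)) *ᵥ x := by
  have hS : star y ⬝ᵥ shift (q + 1) *ᵥ x = ∑ i : Fin q, star (y i.castSucc) * x i.succ := by
    -- At `r = 0` the formula is that of the bare shift.
    have := dotProduct_shiftForm q 0 x y
    simpa using this
  have hI : star y ⬝ᵥ (r • (1 : Matrix (Fin (q + 1)) (Fin (q + 1)) ℂ)) *ᵥ x =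
      star (y 0) * x 0 * r + ∑ i : Fin q, r * (star (y i.succ) * x i.succ) := by
    rw [Matrix.smul_mulVec, Matrix.one_mulVec, dotProduct_smul, dotProduct, Fin.sum_univ_succ]
    simp [Finset.mul_sum]
    ring
  rw [Matrix.sub_mulVec (shift (q + 1)), dotProduct_sub, hS, hI, dotProduct_shiftForm,
    Fin.sum_univ_succ, Fin.sum_univ_succ]
  simp only [Finset.sum_sub_distrib, ← Fin.succ_castSucc, Fin.cons_succ, Fin.castSucc_zero,
    Fin.cons_zero]
  ring

/-- The isotropic extension of a vector by two leading coordinates, the second being `0`. -/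
def isotropicExtension (q : ℕ) : (ℂ × (Fin (q + 1) → ℂ)) →ₗ[ℂ] (Fin (q + 3) → ℂ) where
  toFun p := Fin.cons p.1 (Fin.cons 0 p.2 : Fin (q + 2) → ℂ)
  map_add' a b := by
    ext i
    refine Fin.cases ?_ (fun i => Fin.cases ?_ (fun i => ?_) i) i <;> simp
  map_smul' c a := by
    ext i
    refine Fin.cases ?_ (fun i => Fin.cases ?_ (fun i => ?_) i) i <;> simp

/-- The extension of a vector `x` by the two leading coordinates `-x 0` and an arbitrary one. -/
def negativeExtension (q : ℕ) : (ℂ × (Fin (q + 1) → ℂ)) →ₗ[ℂ] (Fin (q + 3) → ℂ) where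
  toFun p := Fin.cons (-p.2 0) (Fin.cons p.1 p.2 : Fin (q + 2) → ℂ)
  map_add' a b := by
    ext i
    refine Fin.cases ?_ (fun i => Fin.cases ?_ (fun i => ?_) i) i <;> simp [add_comm]
  map_smul' c a := by
    ext i
    refine Fin.cases ?_ (fun i => Fin.cases ?_ (fun i => ?_) i) i <;> simp

theorem isotropicExtension_injective (q : ℕ) : Function.Injective (isotropicExtension q) := by
  rintro ⟨s, x⟩ ⟨t, y⟩ h
  have h' := Fin.cons_injective2 (α := fun _ => ℂ) h
  exact Prod.ext h'.1 (Fin.cons_injective2 (α := fun _ => ℂ) h'.2).2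

theorem negativeExtension_injective (q : ℕ) : Function.Injective (negativeExtension q) := by
  rintro ⟨s, x⟩ ⟨t, y⟩ h
  have h' := Fin.cons_injective2 (α := fun _ => ℂ) (Fin.cons_injective2 (α := fun _ => ℂ) h).2
  exact Prod.ext h'.1 h'.2

theorem finrank_map_top_prod {q : ℕ} {f : (ℂ × (Fin (q + 1) → ℂ)) →ₗ[ℂ] (Fin (q + 3) → ℂ)}
    (hf : Function.Injective f) (W : Submodule ℂ (Fin (q + 1) → ℂ)) :
    finrank ℂ (((⊤ : Submodule ℂ ℂ).prod W).map f) = finrank ℂ W + 1 := by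
  let e : ((⊤ : Submodule ℂ ℂ).prod W) ≃ₗ[ℂ] ℂ × W :=
    { toFun := fun p => (p.1.1, ⟨p.1.2, p.2.2⟩)
      invFun := fun p => ⟨(p.1, p.2.1), trivial, p.2.2⟩
      map_add' := fun _ _ => rfl
      map_smul' := fun _ _ => rfl
      left_inv := fun _ => rfl
      right_inv := fun _ => rfl }
  rw [← (Submodule.equivMapOfInjective f hf _).finrank_eq, e.finrank_eq, Module.finrank_prod,
    Module.finrank_self, add_comm]

/-- With second coordinate `0` all the additional terms vanish, and the first coordinate is free:
this is the extra dimension. -/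
theorem HasIsotropicSubspace.scalarKMS {q j : ℕ} {r : ℝ}
    (h : HasIsotropicSubspace (shift (q + 1) - r • (1 : Matrix _ _ ℂ)) j) :
    HasIsotropicSubspace (scalarKMS (q + 3) r) (j + 1) := by
  obtain ⟨P, hP, hPe⟩ := exists_congr_scalarKMS (q + 3) r
  refine .of_congr hP ?_
  rw [hPe]
  refine .real_smul ?_ r
  obtain ⟨W, rfl, hW⟩ := h
  refine ⟨_, finrank_map_top_prod (isotropicExtension_injective q) W, ?_⟩
  rintro _ ⟨⟨s, x⟩, hx, rfl⟩ _ ⟨⟨t, y⟩, hy, rfl⟩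
  refine (dotProduct_shiftForm_cons q r s 0 t 0 x y).trans ?_
  rw [hW x hx.2 y hy.2]
  simp

/-- First coordinate `-x 0` makes the cross terms in `w` and `x 0` purely imaginary, so the free
coordinate `w` contributes `-r|w|²` to the real part. -/
theorem HasNegativeSubspace.scalarKMS {q l : ℕ} {r : ℝ} (hr : 0 < r)
    (h : HasNegativeSubspace (shift (q + 1) - r • (1 : Matrix _ _ ℂ)) l) :
    HasNegativeSubspace (scalarKMS (q + 3) r) (l + 1) := by
  obtain ⟨P, hP, hPe⟩ := exists_congr_scalarKMS (q + 3) r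
  refine .of_congr hP ?_
  rw [hPe]
  refine .real_smul ?_ hr
  obtain ⟨W, rfl, hW⟩ := h
  refine ⟨_, finrank_map_top_prod (negativeExtension_injective q) W, ?_⟩
  rintro _ ⟨⟨w, x⟩, hx, rfl⟩ hne
  refine (congrArg Complex.re (dotProduct_shiftForm_cons q r (-x 0) w (-x 0) w x x)).trans_lt ?_
  have h1 : (star (-x 0) * w - r * (star w * w) + star w * x 0).re = -(r * Complex.normSq w) := by
    simp [Complex.normSq_apply]
    ring
  rw [Complex.add_re, h1]
  by_cases hx0 : x = 0
  · have hw : w ≠ 0 := by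
      rintro rfl
      exact hne (by rw [hx0]; exact map_zero (negativeExtension q))
    have := mul_pos hr (Complex.normSq_pos.2 hw)
    simpa only [hx0, Matrix.mulVec_zero, dotProduct_zero, Complex.zero_re, add_zero,
      neg_lt_zero] using this
  · have := hW x hx.2 hx0
    have := mul_nonneg hr.le (Complex.normSq_nonneg w)
    linarith

/-! ### Subspaces spanned by eigenvectors -/

open scoped ComplexOrder in
-- Eigenvectors of the Hermitian `M + M*` for distinct eigenvalues are orthogonal, so its quadratic
-- form, which is `2 Re x* M x`, is diagonal on their span.
theorem HasNegativeSubspace.of_eigenvectors {ι κ : Type*} [Fintype ι] [Fintype κ]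
    {M : Matrix ι ι ℂ} {v : κ → ι → ℂ} {c : κ → ℝ} (hv : ∀ a, v a ≠ 0) (hc : Function.Injective c)
    (hneg : ∀ a, c a < 0) (h : ∀ a, (M + Mᴴ) *ᵥ v a = c a • v a) :
    HasNegativeSubspace M (Fintype.card κ) := by
  classical
  have hH : (M + Mᴴ)ᴴ = M + Mᴴ := by simp [add_comm]
  have hort : ∀ a b, a ≠ b → star (v a) ⬝ᵥ v b = 0 := by
    intro a b hab
    have h1 : star (v a) ⬝ᵥ (M + Mᴴ) *ᵥ v b = c b • (star (v a) ⬝ᵥ v b) := by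
      rw [h, dotProduct_smul]
    have h2 : star (v a) ⬝ᵥ (M + Mᴴ) *ᵥ v b = c a • (star (v a) ⬝ᵥ v b) := by
      rw [Matrix.dotProduct_mulVec, ← hH, ← Matrix.star_mulVec, h, star_smul, star_trivial,
        smul_dotProduct]
    have h3 : (c b - c a) • (star (v a) ⬝ᵥ v b) = 0 := by rw [sub_smul, ← h1, ← h2, sub_self]
    exact (smul_eq_zero.1 h3).resolve_left (sub_ne_zero.2 fun e => hab (hc e.symm))
  have hli : LinearIndependent ℂ v := by
    refine Module.End.eigenvectors_linearIndependent' (M + Mᴴ).mulVecLin (fun a => (c a : ℂ))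
      (Complex.ofReal_injective.comp hc) v fun a => ⟨?_, hv a⟩
    rw [Module.End.mem_eigenspace_iff]
    exact h a
  refine ⟨Submodule.span ℂ (Set.range v), finrank_span_eq_card hli, fun x hx hne => ?_⟩
  obtain ⟨g, rfl⟩ := (Submodule.mem_span_range_iff_exists_fun ℂ).1 hx
  set x := ∑ a, g a • v a with hxdef
  have hre : (star x ⬝ᵥ (M + Mᴴ) *ᵥ x).re = 2 * (star x ⬝ᵥ M *ᵥ x).re := by
    have : star x ⬝ᵥ Mᴴ *ᵥ x = star (star x ⬝ᵥ M *ᵥ x) := by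
      rw [Matrix.dotProduct_mulVec, ← Matrix.star_mulVec, Matrix.star_dotProduct]
    rw [Matrix.add_mulVec, dotProduct_add, this, Complex.add_re, Complex.star_def, Complex.conj_re]
    ring
  have hxv : ∀ a, star x ⬝ᵥ v a = star (g a) * (star (v a) ⬝ᵥ v a) := by
    intro a
    rw [hxdef, star_sum, sum_dotProduct, Finset.sum_eq_single a]
    · rw [star_smul, smul_dotProduct, smul_eq_mul]
    · intro b _ hb
      rw [star_smul, smul_dotProduct, hort b a hb, smul_zero]
    · simp
  have hpos : ∀ a, 0 < (star (v a) ⬝ᵥ v a).re := fun a =>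
    (Complex.lt_def.1 (Matrix.dotProduct_star_self_pos_iff.2 (hv a))).1
  have hsum : (star x ⬝ᵥ (M + Mᴴ) *ᵥ x).re =
      ∑ a, c a * Complex.normSq (g a) * (star (v a) ⬝ᵥ v a).re := by
    conv_lhs => rw [show (M + Mᴴ) *ᵥ x = ∑ a, g a • (c a • v a) by
      rw [hxdef, Matrix.mulVec_sum]; simp only [Matrix.mulVec_smul, h]]
    rw [dotProduct_sum, Complex.re_sum]
    refine Finset.sum_congr rfl fun a _ => ?_
    rw [dotProduct_smul, dotProduct_smul, hxv, Complex.real_smul, smul_eq_mul]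
    have : g a * (c a * (star (g a) * (star (v a) ⬝ᵥ v a))) =
        ((c a * Complex.normSq (g a) : ℝ) : ℂ) * (star (v a) ⬝ᵥ v a) := by
      rw [Complex.ofReal_mul, Complex.normSq_eq_conj_mul_self, Complex.star_def]
      ring
    rw [this, Complex.re_ofReal_mul]
  have hg : ∃ a, g a ≠ 0 := by
    by_contra! hg
    exact hne (by simp [hxdef, hg])
  obtain ⟨a, ha⟩ := hg
  have : ∑ a, c a * Complex.normSq (g a) * (star (v a) ⬝ᵥ v a).re < 0 := by
    refine Finset.sum_neg' (fun b _ => ?_) ⟨a, Finset.mem_univ a, ?_⟩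
    · exact mul_nonpos_of_nonpos_of_nonneg (mul_nonpos_of_nonpos_of_nonneg (hneg b).le
        (Complex.normSq_nonneg _)) (hpos b).le
    · exact mul_neg_of_neg_of_pos (mul_neg_of_neg_of_pos (hneg a) (Complex.normSq_pos.2 ha))
        (hpos a)
  linarith

/-- Applying `v_b* M v_a = μ_a conj(v_a* M v_b)` twice multiplies `v_b* M v_a` by `μ_a μ_b`, which
exceeds `1` for distinct values `≤ -1`. On the diagonal the relation kills the real part; the
condition on the imaginary part is essential at `μ = -1`, where the relation says nothing about it.
-/
theorem HasIsotropicSubspace.of_pencil {ι κ : Type*} [Fintype ι] [DecidableEq ι] [Fintype κ]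
    {M : Matrix ι ι ℂ} (hM : IsUnit M) {v : κ → ι → ℂ} {μ : κ → ℝ} (hv : ∀ a, v a ≠ 0)
    (hμ : Function.Injective μ) (hle : ∀ a, μ a ≤ -1) (h : ∀ a, M *ᵥ v a = μ a • Mᴴ *ᵥ v a)
    (him : ∀ a, (star (v a) ⬝ᵥ M *ᵥ v a).im = 0) :
    HasIsotropicSubspace M (Fintype.card κ) := by
  have hMH : IsUnit Mᴴ.det := by
    rw [← Matrix.isUnit_iff_isUnit_det]
    exact hM.star
  have hli : LinearIndependent ℂ v := by
    refine Module.End.eigenvectors_linearIndependent' (Mᴴ⁻¹ * M).mulVecLin (fun a => (μ a : ℂ))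
      (Complex.ofReal_injective.comp hμ) v fun a => ⟨?_, hv a⟩
    rw [Module.End.mem_eigenspace_iff, Matrix.mulVecLin_apply, ← Matrix.mulVec_mulVec, h,
      Matrix.mulVec_smul, Matrix.mulVec_mulVec, Matrix.nonsing_inv_mul _ hMH, Matrix.one_mulVec]
    rfl
  have key : ∀ a b, star (v b) ⬝ᵥ M *ᵥ v a = μ a * star (star (v a) ⬝ᵥ M *ᵥ v b) := by
    intro a b
    rw [h, dotProduct_smul, Matrix.dotProduct_mulVec, ← Matrix.star_mulVec,
      Matrix.star_dotProduct, Complex.real_smul]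
  refine .of_linearIndependent hli fun a b => ?_
  rcases eq_or_ne a b with rfl | hab
  · have h1 := congrArg Complex.re (key a a)
    rw [Complex.re_ofReal_mul, Complex.star_def, Complex.conj_re] at h1
    have h2 : (star (v a) ⬝ᵥ M *ᵥ v a).re = 0 := by
      have := hle a
      have h3 : (1 - μ a) * (star (v a) ⬝ᵥ M *ᵥ v a).re = 0 := by linarith
      exact (mul_eq_zero.1 h3).resolve_left (by linarith)
    exact Complex.ext h2 (him a)
  · have h1 : ((1 - μ a * μ b : ℝ) : ℂ) * (star (v b) ⬝ᵥ M *ᵥ v a) = 0 := by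
      have := key a b
      rw [key b a] at this
      simp only [star_mul', Complex.star_def, Complex.conj_ofReal, Complex.conj_conj] at this
      push_cast
      linear_combination this
    refine (mul_eq_zero.1 h1).resolve_left ?_
    rw [Complex.ofReal_eq_zero]
    have hne := hμ.ne hab
    rcases lt_or_gt_of_ne hne with hlt | hlt <;> nlinarith [hle a, hle b]

/-! ### Sine eigenvectors of the shift -/

/-- The first `p` positive-index terms of a real sequence, as a complex vector. -/
def truncation (p : ℕ) (f : ℕ → ℝ) : Fin p → ℂ := fun i => (f (i + 1) : ℂ)

theorem shift_mulVec_truncation {p : ℕ} {f : ℕ → ℝ} (hf : f (p + 1) = 0) (i : Fin p) :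
    (shift p *ᵥ truncation p f) i = f (i + 2) := by
  rw [shift_mulVec_apply]
  split_ifs with h
  · rfl
  · have : (i : ℕ) + 2 = p + 1 := by have := i.2; omega
    rw [this, hf, Complex.ofReal_zero]

theorem shift_conjTranspose_mulVec_truncation {p : ℕ} {f : ℕ → ℝ} (hf : f 0 = 0) (i : Fin p) :
    ((shift p)ᴴ *ᵥ truncation p f) i = f i := by
  simp only [Matrix.mulVec, dotProduct, Matrix.conjTranspose_apply, shift, Matrix.of_apply,
    apply_ite star, star_one, star_zero, ite_mul, one_mul, zero_mul]
  obtain ⟨i, hi⟩ := i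
  cases i with
  | zero => simp [hf]
  | succ i =>
    rw [Finset.sum_eq_single ⟨i, by omega⟩]
    · simp [truncation]
    · intro j _ hj
      rw [if_neg]
      exact fun h => hj (Fin.ext (by simpa using h))
    · simp

/-- The angles `(l + 1) π / (p + 1)`. -/
noncomputable def shiftAngle (p l : ℕ) : ℝ := (l + 1 : ℝ) * Real.pi / (p + 1)

theorem shiftAngle_pos (p l : ℕ) : 0 < shiftAngle p l := by
  unfold shiftAngle
  positivity

theorem shiftAngle_lt_pi {p l : ℕ} (h : l < p) : shiftAngle p l < Real.pi := by
  unfold shiftAngle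
  rw [div_lt_iff₀ (by positivity), mul_comm]
  have : (l : ℝ) < p := by exact_mod_cast h
  gcongr

theorem shiftAngle_injective (p : ℕ) : Function.Injective (shiftAngle p) := by
  intro a b h
  unfold shiftAngle at h
  have hp : (p : ℝ) + 1 ≠ 0 := by positivity
  field_simp at h
  exact_mod_cast add_right_cancel h

theorem sin_mul_shiftAngle (p l : ℕ) : Real.sin ((p + 1 : ℕ) * shiftAngle p l) = 0 := by
  have hp : (p : ℝ) + 1 ≠ 0 := by positivity
  rw [show ((p + 1 : ℕ) : ℝ) * shiftAngle p l = (l + 1 : ℕ) * Real.pi by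
    unfold shiftAngle; push_cast; field_simp, Real.sin_nat_mul_pi]

theorem cos_shiftAngle_injOn (p : ℕ) {a b : ℕ} (ha : a < p) (hb : b < p)
    (h : Real.cos (shiftAngle p a) = Real.cos (shiftAngle p b)) : a = b :=
  shiftAngle_injective p (Real.injOn_cos ⟨(shiftAngle_pos p a).le, (shiftAngle_lt_pi ha).le⟩
    ⟨(shiftAngle_pos p b).le, (shiftAngle_lt_pi hb).le⟩ h)

theorem sin_add_sin_eq (θ : ℝ) (i : ℕ) :
    Real.sin ((i + 2 : ℕ) * θ) + Real.sin (i * θ) =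
      2 * Real.cos θ * Real.sin ((i + 1 : ℕ) * θ) := by
  have h1 : ((i + 2 : ℕ) : ℝ) * θ = (i + 1 : ℕ) * θ + θ := by push_cast; ring
  have h2 : (i : ℝ) * θ = (i + 1 : ℕ) * θ - θ := by push_cast; ring
  rw [h1, h2, Real.sin_add, Real.sin_sub]
  ring

theorem truncation_ne_zero {p : ℕ} (hp : 0 < p) {f : ℕ → ℝ} (hf : f 1 ≠ 0) :
    truncation p f ≠ 0 := by
  intro h
  have := congrFun h ⟨0, hp⟩
  simp [truncation, hf] at this

/-- The vectors `sin(iθ)` vanish at `i = 0` and `i = p + 1`, so the sine recursion makes them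
eigenvectors of `S + S*` with eigenvalue `2 cos θ`. The angles with index at least `j` are used. -/
theorem hasNegativeSubspace_shift_sub {p j : ℕ} {r : ℝ}
    (h : ∀ l, j ≤ l → l < p → Real.cos (shiftAngle p l) < r) :
    HasNegativeSubspace (shift p - r • (1 : Matrix _ _ ℂ)) (p - j) := by
  have := HasNegativeSubspace.of_eigenvectors (κ := Fin (p - j))
    (M := shift p - r • (1 : Matrix _ _ ℂ))
    (v := fun a => truncation p fun i => Real.sin (i * shiftAngle p (j + a)))
    (c := fun a => 2 * (Real.cos (shiftAngle p (j + a)) - r)) ?_ ?_ ?_ ?_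
  · simpa using this
  · intro a
    have hp : 0 < p := by have := a.2; omega
    refine truncation_ne_zero hp ?_
    rw [Nat.cast_one, one_mul]
    exact (Real.sin_pos_of_pos_of_lt_pi (shiftAngle_pos _ _) (shiftAngle_lt_pi (by omega))).ne'
  · intro a b hab
    have : (j + a : ℕ) = j + b := cos_shiftAngle_injOn p (by omega) (by omega) (by
      simpa using hab)
    exact Fin.ext (by omega)
  · intro a
    have := h (j + a) (by omega) (by omega)
    linarith
  · intro a
    ext i
    have h1 := shift_mulVec_truncation (p := p)
      (f := fun i => Real.sin (i * shiftAngle p (j + a))) (sin_mul_shiftAngle p _) i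
    have h2 := shift_conjTranspose_mulVec_truncation (p := p)
      (f := fun i => Real.sin (i * shiftAngle p (j + a))) (by simp) i
    have h3 := sin_add_sin_eq (shiftAngle p (j + a)) i
    rw [Matrix.conjTranspose_sub, Matrix.conjTranspose_smul, Matrix.conjTranspose_one,
      star_trivial, Matrix.add_mulVec, Matrix.sub_mulVec, Matrix.sub_mulVec, Matrix.smul_mulVec,
      Matrix.one_mulVec]
    simp only [Pi.add_apply, Pi.sub_apply, Pi.smul_apply, h1, h2, Complex.real_smul]
    simp only [truncation]
    have h4 := congrArg (fun x : ℝ => (x : ℂ)) h3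
    push_cast at h4 ⊢
    linear_combination h4

/-- The weighted vectors `q^i sin(iθ)` solve `Mv = -q² M* v` when `r(q² + 1) = 2q cos θ`. Such a
real `q ≥ 1` exists precisely because `r ≤ cos θ`. -/
theorem hasIsotropicSubspace_shift_sub {p j : ℕ} {r : ℝ} (hr : 0 < r) (hj : j ≤ p)
    (h : ∀ l < j, r ≤ Real.cos (shiftAngle p l)) :
    HasIsotropicSubspace (shift p - r • (1 : Matrix _ _ ℂ)) j := by
  have hq : ∀ a : Fin j, ∃ q : ℝ, 1 ≤ q ∧ r * (q ^ 2 + 1) = 2 * q * Real.cos (shiftAngle p a) := by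
    intro a
    set c := Real.cos (shiftAngle p a)
    have hc : 1 ≤ c / r := (one_le_div hr).2 (h a a.2)
    have hs : 0 ≤ (c / r) ^ 2 - 1 := by nlinarith
    -- The larger root of `r q² - 2cq + r`; the two roots have product `1`.
    refine ⟨c / r + √((c / r) ^ 2 - 1), by linarith [Real.sqrt_nonneg ((c / r) ^ 2 - 1)], ?_⟩
    have h1 := Real.sq_sqrt hs
    have h2 : c = r * (c / r) := by field_simp
    generalize √((c / r) ^ 2 - 1) = t at h1 ⊢
    generalize c / r = d at h1 h2 ⊢
    rw [h2]
    linear_combination r * h1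
  choose q hq1 hq2 using hq
  have := HasIsotropicSubspace.of_pencil (κ := Fin j)
    (M := shift p - r • (1 : Matrix _ _ ℂ))
    (v := fun a => truncation p fun i => q a ^ i * Real.sin (i * shiftAngle p a))
    (μ := fun a => -q a ^ 2) ?_ ?_ ?_ ?_ ?_ ?_
  · simpa using this
  · refine isUnit_of_upperTriangular (fun a b hab => ?_) fun a => ?_
    · have hne : a ≠ b := hab.ne'
      rw [Fin.lt_def] at hab
      simp [shift, Matrix.one_apply_ne hne, show ¬ ((a : ℕ) + 1 = b) by omega]
    · simp [shift, hr.ne']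
  · intro a
    have hp : 0 < p := by have := a.2; omega
    refine truncation_ne_zero hp ?_
    rw [Nat.cast_one, one_mul, pow_one]
    exact (mul_pos (zero_lt_one.trans_le (hq1 a)) (Real.sin_pos_of_pos_of_lt_pi
      (shiftAngle_pos _ _) (shiftAngle_lt_pi (by omega)))).ne'
  · intro a b hab
    have hqa := zero_lt_one.trans_le (hq1 a)
    have hqb := zero_lt_one.trans_le (hq1 b)
    have hab' : q a = q b := (sq_eq_sq₀ hqa.le hqb.le).1 (neg_injective hab)
    -- The value of `q` determines `cos θ`, hence the angle.
    have h1 := hq2 a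
    rw [hab', hq2 b] at h1
    exact Fin.ext (cos_shiftAngle_injOn p (by omega) (by omega)
      (mul_left_cancel₀ (mul_pos two_pos hqb).ne' h1).symm)
  · intro a
    have := hq1 a
    nlinarith
  · intro a
    ext i
    have h1 := shift_mulVec_truncation (p := p)
      (f := fun i => q a ^ i * Real.sin (i * shiftAngle p a)) (by simp only [sin_mul_shiftAngle, mul_zero]) i
    have h2 := shift_conjTranspose_mulVec_truncation (p := p)
      (f := fun i => q a ^ i * Real.sin (i * shiftAngle p a)) (by simp) i
    have h3 := sin_add_sin_eq (shiftAngle p a) i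
    rw [Matrix.conjTranspose_sub, Matrix.conjTranspose_smul, Matrix.conjTranspose_one,
      star_trivial, Matrix.sub_mulVec, Matrix.sub_mulVec, Matrix.smul_mulVec, Matrix.one_mulVec]
    simp only [Pi.sub_apply, Pi.smul_apply, h1, h2, Complex.real_smul]
    simp only [truncation]
    have h4 : q a ^ ((i : ℕ) + 2) * Real.sin ((i + 2 : ℕ) * shiftAngle p a) -
        r * (q a ^ ((i : ℕ) + 1) * Real.sin ((i + 1 : ℕ) * shiftAngle p a)) =
        (-q a ^ 2) * (q a ^ (i : ℕ) * Real.sin (i * shiftAngle p a) -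
        r * (q a ^ ((i : ℕ) + 1) * Real.sin ((i + 1 : ℕ) * shiftAngle p a))) := by
      linear_combination q a ^ ((i : ℕ) + 2) * h3 -
        q a ^ ((i : ℕ) + 1) * Real.sin ((i + 1 : ℕ) * shiftAngle p a) * hq2 a
    exact_mod_cast congrArg (fun x : ℝ => (x : ℂ)) h4
  · intro a
    have h1 := shift_mulVec_truncation (p := p)
      (f := fun i => q a ^ i * Real.sin (i * shiftAngle p a)) (by simp only [sin_mul_shiftAngle, mul_zero])
    rw [Matrix.sub_mulVec, Matrix.smul_mulVec, Matrix.one_mulVec, dotProduct, Complex.im_sum]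
    refine Finset.sum_eq_zero fun i _ => ?_
    simp only [Pi.sub_apply, Pi.smul_apply, h1, Pi.star_apply, truncation, Complex.real_smul,
      Complex.star_def, Complex.conj_ofReal]
    rw [← Complex.ofReal_mul, ← Complex.ofReal_sub, ← Complex.ofReal_mul, Complex.ofReal_im]

/-! ### The cosine index and the conclusion -/

/-- Cosine decreases on `[0, π]`, so the bracket at `j + 1` says that exactly the first `j` cosines
are at least `r`. -/
theorem exists_cosIndex_eq (p : ℕ) (hp : 0 < p) {r : ℝ} (hr : 0 < r) :
    ∃ j ≤ p, cosIndex (p + 2) r = j + 1 ∧ (∀ l < j, r ≤ Real.cos (shiftAngle p l)) ∧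
      ∀ l, j ≤ l → l < p → Real.cos (shiftAngle p l) < r := by
  have hmono : ∀ {a b : ℕ}, a ≤ b → b < p →
      Real.cos (shiftAngle p b) ≤ Real.cos (shiftAngle p a) := by
    intro a b hab hb
    refine Real.cos_le_cos_of_nonneg_of_le_pi (shiftAngle_pos p a).le (shiftAngle_lt_pi hb).le ?_
    unfold shiftAngle
    gcongr
  have hmem : ∀ l, l + 1 ∈ cosIndices (p + 2) r ↔
      l < p ∧ Real.cos (shiftAngle p l) < r ∧ r ≤ Real.cos (l * Real.pi / (p + 1)) := by
    intro l
    rw [cosIndices, Finset.mem_filter, Finset.mem_Icc]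
    have e1 : ((p + 2 : ℕ) : ℝ) - 1 = p + 1 := by push_cast; ring
    have e2 : ((l + 1 : ℕ) : ℝ) - 1 = l := by push_cast; ring
    rw [e1, e2, shiftAngle, Nat.cast_add_one]
    refine and_congr_left fun _ => ?_
    omega
  unfold cosIndex
  split_ifs with hne
  · have hk := Finset.max'_mem _ hne
    obtain ⟨j, hj⟩ : ∃ j, (cosIndices (p + 2) r).max' hne = j + 1 := by
      refine Nat.exists_eq_add_one.2 ?_
      exact (Finset.mem_Icc.1 (Finset.mem_filter.1 hk).1).1
    rw [hj, hmem] at hk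
    refine ⟨j, hk.1.le, hj, fun l hl => ?_, fun l hl hlp => (hmono hl hlp).trans_lt hk.2.1⟩
    refine hk.2.2.trans ?_
    obtain ⟨i, rfl⟩ := Nat.exists_eq_add_one.2 (Nat.zero_lt_of_lt hl)
    have := hmono (Nat.le_of_lt_succ hl) (Nat.lt_of_succ_lt hk.1)
    rwa [shiftAngle, ← Nat.cast_add_one] at this
  -- The default index `1` corresponds to `j = 0`. If `r` were at most the first cosine, the first
  -- cosine below `r` would give an admissible index; one exists because the last angle `pπ/(p+1)`
  -- is at least `π/2` and `r > 0`.
  · refine ⟨0, Nat.zero_le _, rfl, fun l hl => absurd hl (Nat.not_lt_zero l), fun l _ hlp => ?_⟩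
    refine (hmono (Nat.zero_le l) hlp).trans_lt ?_
    by_contra! hle
    have hex : ∃ l, l < p ∧ Real.cos (shiftAngle p l) < r := by
      refine ⟨p - 1, by omega, lt_of_le_of_lt ?_ hr⟩
      refine Real.cos_nonpos_of_pi_div_two_le_of_le ?_ ?_
      · have h1 : (1 : ℝ) ≤ p := by exact_mod_cast hp
        rw [shiftAngle, Nat.cast_sub (by omega), div_le_div_iff₀ (by norm_num) (by positivity)]
        push_cast
        nlinarith [Real.pi_pos]
      · linarith [shiftAngle_lt_pi (p := p) (l := p - 1) (by omega), Real.pi_pos]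
    classical
    obtain ⟨h1, h2⟩ := Nat.find_spec hex
    obtain ⟨i, hi⟩ : ∃ i, Nat.find hex = i + 1 := by
      refine Nat.exists_eq_add_one.2 (Nat.pos_of_ne_zero fun h0 => ?_)
      rw [h0] at h2
      linarith
    have h3 : r ≤ Real.cos (shiftAngle p i) := by
      by_contra! hlt
      exact Nat.find_min hex (m := i) (by omega) ⟨by omega, hlt⟩
    refine hne ⟨Nat.find hex + 1, (hmem _).2 ⟨h1, h2, ?_⟩⟩
    rw [hi, Nat.cast_add_one]
    exact h3

theorem exists_subspaces_scalarKMS {m : ℕ} (hm : 3 ≤ m) {z : ℂ} (hz : z ≠ 0) :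
    HasIsotropicSubspace (scalarKMS m z) (cosIndex m ‖z‖) ∧
      ∃ l, HasNegativeSubspace (scalarKMS m z) l ∧ m ≤ cosIndex m ‖z‖ + l := by
  obtain ⟨q, rfl⟩ := Nat.exists_eq_add_of_le' hm
  have hr : 0 < ‖z‖ := norm_pos_iff.2 hz
  obtain ⟨P, hP, hPe⟩ := exists_congr_scalarKMS_norm (q + 3) hz
  obtain ⟨j, hj, hcos, h1, h2⟩ := exists_cosIndex_eq (q + 1) q.succ_pos hr
  rw [show q + 3 = q + 1 + 2 from rfl, hcos]
  -- With `p = q + 1` the dimensions `j + 1` and `p - j + 1` add up to `p + 2 = m`.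
  refine ⟨.of_congr hP ?_, q + 1 - j + 1, .of_congr hP ?_, by omega⟩
  · exact hPe ▸ (hasIsotropicSubspace_shift_sub hr hj h1).scalarKMS
  · exact hPe ▸ (hasNegativeSubspace_shift_sub h2).scalarKMS hr

end BlockKMS

theorem mainTheorem4 (m n : ℕ) (hm : 3 ≤ m) (A : Matrix (Fin n) (Fin n) ℂ)
    (hA : A.det ≠ 0) (hN : IsStarNormal A)
    (lam : Fin n → ℂ) (hlam : A.charpoly.roots = Finset.univ.val.map lam) :
    BlockKMS.zeroDilationIndex (BlockKMS.kms m A) =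
      ∑ i : Fin n, BlockKMS.cosIndex m ‖lam i‖ := by
  obtain ⟨U, hU, μ, h⟩ := BlockKMS.exists_unitary_mul_eq_mul_diagonal A hN
  have hmap := BlockKMS.map_eq_map_of_mul_eq_mul_diagonal hU h hlam
  have hμ : ∀ a, μ a ≠ 0 := by
    have hdet := congrArg Matrix.det h
    rw [Matrix.det_mul, Matrix.det_mul, mul_comm, Matrix.det_diagonal] at hdet
    have hU0 : U.det ≠ 0 := (Matrix.isUnit_iff_isUnit_det U).1
      (Unitary.toUnits ⟨U, hU⟩).isUnit |>.ne_zero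
    rw [mul_left_cancel₀ hU0 hdet, Finset.prod_ne_zero_iff] at hA
    exact fun a => hA a (Finset.mem_univ a)
  have hsum : ∑ i, BlockKMS.cosIndex m ‖lam i‖ = ∑ a, BlockKMS.cosIndex m ‖μ a‖ := by
    have := congrArg (fun s => (s.map fun z => BlockKMS.cosIndex m ‖z‖).sum) hmap
    simp only [Multiset.map_map] at this
    exact this.symm
  have hs := fun a => BlockKMS.exists_subspaces_scalarKMS hm (hμ a)
  choose l hl hle using fun a => (hs a).2
  obtain ⟨P, hP, hPe⟩ := BlockKMS.exists_congr_kms m hU h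
  rw [hsum]
  refine BlockKMS.zeroDilationIndex_eq (.of_congr hP ?_)
    (.of_congr hP (hPe ▸ BlockKMS.HasNegativeSubspace.blockDiagonal hl)) ?_
  · exact hPe ▸ BlockKMS.HasIsotropicSubspace.blockDiagonal fun a => (hs a).1
  · rw [← Finset.sum_add_distrib, Fintype.card_prod, Fintype.card_fin, Fintype.card_fin]
    refine le_trans ?_ (Finset.sum_le_sum fun a _ => hle a)
    simp [mul_comm]
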